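/- For non-zero integers $s_1,\dots,s_r$ and $N\ge 0$ put $$\zeta_N(s_1,\dots,s_r)=\sum_{N\ge n_1>\cdots>n_r\ge 1}\ \prod_{j=1}^r \frac{\operatorname{sgn}(s_j)^{n_j}}{n_j^{|s_j|}},\qquad \zeta(s_1,\dots,s_r)=\lim_{N\to\infty}\zeta_N(s_1,\dots,s_r)$$ whenever the limit exists. Write $\bar p$ for a negative entry $-p$, and $\{1\}_d$ for the entry $1$ repeated $d$ times (no entry if $d=0$). For positive integers $s_1,\dots,s_r$ with $r\ge 1$ and real $0\le x<1$ let $$\mathrm{Li}_{s_1,\dots,s_r}(x)=\sum_{n_1>\cdots>n_r>0}\frac{x^{n_1}}{n_1^{s_1}\cdots n_r^{s_r}}$$ be the multiple polylogarithm. Then for all integers $m,k\ge 0$ the series defining $\mathrm{Li}_{k+2,\{1\}_m}(1/2)$ converges absolutely, the limit defining $\zeta(\bar 1,\{1\}_m,\bar 1,\{1\}_k)$ exists, and $$\zeta(\bar 1,\{1\}_m,\bar 1,\{1\}_k)=(-1)^{m+1}\,\mathrm{Li}_{k+2,\{1\}_m}\!\left(\tfrac12\right).$$ -/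

import Mathlib

open scoped Topology
open Filter

noncomputable section

/-- The strictly decreasing `r`-tuples `N ≥ n₁ > n₂ > ⋯ > n_r ≥ 1`
(the entry `n_{j+1}` of the usual notation is `n j`). -/
def decreasingTuples (N r : ℕ) : Finset (Fin r → ℕ) :=
  (Fintype.piFinset fun _ : Fin r => Finset.Icc 1 N).filter
    fun n => ∀ i j : Fin r, i < j → n j < n i

/-- The multiple harmonic number
`ζ_N(s₁, …, s_r) = ∑_{N ≥ n₁ > ⋯ > n_r ≥ 1} ∏_j sgn(s_j)^{n_j} / n_j^{|s_j|}`
of a vector `s` of non-zero integers; a barred entry `p̄` is the negative entry `-p`. -/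
def multipleHarmonic (N : ℕ) {r : ℕ} (s : Fin r → ℤ) : ℝ :=
  ∑ n ∈ decreasingTuples N r,
    ∏ j : Fin r, ((s j).sign : ℝ) ^ (n j) / (n j : ℝ) ^ (s j).natAbs

/-- The (possibly only conditionally convergent) series
`ζ(s₁, …, s_r) = ∑_{n₁ > ⋯ > n_r > 0} ∏_j sgn(s_j)^{n_j} / n_j^{|s_j|}`
converges to `z`, in the sense that its partial sums `ζ_N(s₁, …, s_r)`, over the tuples with
`n₁ ≤ N`, tend to `z` as `N → ∞`. -/
def HasMultipleZetaValue {r : ℕ} (s : Fin r → ℤ) (z : ℝ) : Prop :=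
  Tendsto (fun N : ℕ => multipleHarmonic N s) atTop (𝓝 z)

/-- The index set `n₁ > n₂ > ⋯ > n_r > 0` of the multiple polylogarithm series. -/
abbrev PosDecreasing (r : ℕ) : Type :=
  {n : Fin r → ℕ // (∀ i j : Fin r, i < j → n j < n i) ∧ ∀ i : Fin r, 0 < n i}

/-- The term `x^{n₁} / (n₁^{s₁} ⋯ n_{r+1}^{s_{r+1}})` of the multiple polylogarithm series. -/
def multiplePolylogTerm {r : ℕ} (s : Fin (r + 1) → ℕ) (x : ℝ) (n : PosDecreasing (r + 1)) : ℝ :=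
  x ^ (n.1 0) / ∏ j : Fin (r + 1), (n.1 j : ℝ) ^ (s j)

/-- The multiple polylogarithm
`Li_{s₁, …, s_{r+1}}(x) = ∑_{n₁ > ⋯ > n_{r+1} > 0} x^{n₁} / (n₁^{s₁} ⋯ n_{r+1}^{s_{r+1}})`. -/
def multiplePolylog {r : ℕ} (s : Fin (r + 1) → ℕ) (x : ℝ) : ℝ :=
  ∑' n : PosDecreasing (r + 1), multiplePolylogTerm s x n

/-- The vector `(1̄, {1}_m, 1̄, {1}_k)`. -/
def zetaIndex (m k : ℕ) : Fin (m + (k + 1) + 1) → ℤ :=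
  Matrix.vecCons (-1)
    (Fin.append (fun _ : Fin m => 1) (Matrix.vecCons (-1) fun _ : Fin k => 1))

/-- The vector `(k + 2, {1}_m)`. -/
def polylogIndex (m k : ℕ) : Fin (m + 1) → ℕ :=
  Matrix.vecCons (k + 2) fun _ : Fin m => 1

end

open Finset.HasAntidiagonal (antidiagonal)

/-! Both sides come from one function of `v` on `(0, 1)`. Put `L_0(x) = (-log (1 + x))^(k+1) /
(k+1)!` and let `L_{j+1}` be the primitive of `L_j(x) / (1 - x)` vanishing at `0`. The coefficients
of `L_{m+1}` are the summands of the nested sums, so Abel's theorem gives the zeta value as the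
limit of `L_{m+1}(x)` at `x → -1⁺`, once the series is known to converge
(`exists_tendsto_nestedSum_neg_one`).

Substitute `x = 2v - 1`. Integrating by parts repeatedly, `∑ L_{i+1}(2v - 1) log(1 - v)^j / j!` over
`i + j = m` and `∑ Li_{p+1,{1}_m}(v) (-log 2v)^q / q!` over `p + q = k + 1` have the same derivative
up to the factor `(-1)^m` (`hasDerivAt_sum_antidiagonal`). At `v = 1/2` the first sum vanishes and
the second is `Li_{k+2,{1}_m}(1/2)`, which fixes the constant (`sum_alternatingPolylog_eq`). As `v →
0⁺` the first tends to the zeta value and the second to `0`. -/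

/-! ### Multiple harmonic sums as iterated nested sums -/

/-- The nested sum operator `A ↦ (N ↦ ∑_{N ≥ n ≥ 1} ε ^ n / n * A (n - 1))`. -/
noncomputable def nestedSum (ε : ℝ) (A : ℕ → ℝ) (N : ℕ) : ℝ :=
  ∑ i ∈ Finset.range N, ε ^ (i + 1) / ((i : ℝ) + 1) * A i

theorem nestedSum_zero (ε : ℝ) (A : ℕ → ℝ) : nestedSum ε A 0 = 0 := by
  simp [nestedSum]

theorem nestedSum_succ (ε : ℝ) (A : ℕ → ℝ) (N : ℕ) :
    nestedSum ε A (N + 1) = nestedSum ε A N + ε ^ (N + 1) / ((N : ℝ) + 1) * A N :=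
  Finset.sum_range_succ _ _

theorem mem_decreasingTuples {N r : ℕ} {n : Fin r → ℕ} :
    n ∈ decreasingTuples N r ↔
      (∀ i, 1 ≤ n i ∧ n i ≤ N) ∧ ∀ i j : Fin r, i < j → n j < n i := by
  simp [decreasingTuples, Fintype.mem_piFinset]

theorem cons_mem_decreasingTuples {N r i : ℕ} {n : Fin r → ℕ} (hi : i < N)
    (hn : n ∈ decreasingTuples i r) :
    (Fin.cons (i + 1) n : Fin (r + 1) → ℕ) ∈ decreasingTuples N (r + 1) := by
  rw [mem_decreasingTuples] at hn ⊢
  obtain ⟨h1, h2⟩ := hn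
  refine ⟨fun j => ?_, fun a b hab => ?_⟩
  · refine Fin.cases ?_ (fun j => ?_) j
    · simp only [Fin.cons_zero]; omega
    · simp only [Fin.cons_succ]; have := h1 j; omega
  · induction b using Fin.cases with
    | zero => exact absurd hab (Fin.not_lt_zero _)
    | succ b =>
      induction a using Fin.cases with
      | zero => simp only [Fin.cons_zero, Fin.cons_succ]; have := h1 b; omega
      | succ a =>
        simp only [Fin.cons_succ]
        exact h2 a b (Fin.succ_lt_succ_iff.1 hab)

theorem tail_mem_decreasingTuples {r : ℕ} {n : Fin (r + 1) → ℕ}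
    (hdec : ∀ i j : Fin (r + 1), i < j → n j < n i) (hpos : ∀ i, 0 < n i) :
    Fin.tail n ∈ decreasingTuples (n 0 - 1) r := by
  rw [mem_decreasingTuples]
  refine ⟨fun j => ⟨hpos _, ?_⟩, fun a b hab => hdec _ _ (Fin.succ_lt_succ_iff.2 hab)⟩
  have := hdec 0 j.succ (Fin.succ_pos j)
  simp only [Fin.tail]
  omega

theorem multipleHarmonic_cons (N : ℕ) {r : ℕ} (p : ℤ) (s : Fin r → ℤ) :
    multipleHarmonic N (Matrix.vecCons p s) =
      ∑ i ∈ Finset.range N, (p.sign : ℝ) ^ (i + 1) / ((i : ℝ) + 1) ^ p.natAbs *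
        multipleHarmonic i s := by
  simp only [multipleHarmonic, Finset.mul_sum]
  rw [Finset.sum_sigma' (Finset.range N) (fun i => decreasingTuples i r)]
  refine Finset.sum_bij' (fun n _ => ⟨n 0 - 1, Fin.tail n⟩) (fun x _ => Fin.cons (x.1 + 1) x.2)
    ?_ ?_ ?_ ?_ ?_
  · intro n hn
    rw [mem_decreasingTuples] at hn
    rw [Finset.mem_sigma, Finset.mem_range]
    refine ⟨?_, tail_mem_decreasingTuples hn.2 fun i => (hn.1 i).1⟩
    have := hn.1 0
    dsimp only
    omega
  · rintro ⟨i, n⟩ hx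
    rw [Finset.mem_sigma, Finset.mem_range] at hx
    exact cons_mem_decreasingTuples hx.1 hx.2
  · intro n hn
    rw [mem_decreasingTuples] at hn
    have := (hn.1 0).1
    have h : n 0 - 1 + 1 = n 0 := by omega
    simp only [h, Fin.cons_self_tail]
  · rintro ⟨i, n⟩ hx
    simp
  · intro n hn
    rw [mem_decreasingTuples] at hn
    have := (hn.1 0).1
    have h : n 0 - 1 + 1 = n 0 := by omega
    have h' : ((n 0 - 1 : ℕ) : ℝ) + 1 = n 0 := by exact_mod_cast h
    rw [Fin.prod_univ_succ]
    simp only [h, h']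
    rfl

theorem multipleHarmonic_cast {r r' : ℕ} (h : r' = r) (N : ℕ) (s : Fin r → ℤ) :
    multipleHarmonic N (s ∘ Fin.cast h) = multipleHarmonic N s := by
  subst h; rfl

theorem multipleHarmonic_cons_one {r : ℕ} (s : Fin r → ℤ) :
    (fun N => multipleHarmonic N (Matrix.vecCons 1 s)) =
      nestedSum 1 fun N => multipleHarmonic N s := by
  funext N; simp [multipleHarmonic_cons, nestedSum]

theorem multipleHarmonic_cons_neg_one {r : ℕ} (s : Fin r → ℤ) :
    (fun N => multipleHarmonic N (Matrix.vecCons (-1) s)) =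
      nestedSum (-1) fun N => multipleHarmonic N s := by
  funext N; simp [multipleHarmonic_cons, nestedSum]

theorem multipleHarmonic_ones_append (m : ℕ) {r : ℕ} (s : Fin r → ℤ) :
    (fun N => multipleHarmonic N (Fin.append (fun _ : Fin m => 1) s)) =
      (nestedSum 1)^[m] fun N => multipleHarmonic N s := by
  induction m with
  | zero =>
    funext N
    rw [Fin.append_left_nil _ _ rfl, multipleHarmonic_cast]
    rfl
  | succ m ih =>
    rw [Function.iterate_succ_apply', ← ih, ← multipleHarmonic_cons_one]
    funext N
    have h : (fun _ : Fin (m + 1) => (1 : ℤ)) = Fin.cons 1 fun _ : Fin m => 1 := by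
      funext j
      refine Fin.cases ?_ (fun j => ?_) j <;> simp
    rw [h, Fin.append_cons, multipleHarmonic_cast]
    rfl

/-- The elementary symmetric function of degree `r` of `1, 1/2, …, 1/N`. -/
noncomputable def harmonicSymm (r : ℕ) : ℕ → ℝ := (nestedSum 1)^[r] fun _ => 1

theorem harmonicSymm_succ (r : ℕ) : harmonicSymm (r + 1) = nestedSum 1 (harmonicSymm r) :=
  Function.iterate_succ_apply' _ _ _

theorem multipleHarmonic_ones (r : ℕ) :
    (fun N => multipleHarmonic N fun _ : Fin r => 1) = harmonicSymm r := by
  induction r with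
  | zero =>
    funext N
    simp [multipleHarmonic, harmonicSymm, decreasingTuples]
  | succ r ih =>
    rw [harmonicSymm_succ, ← ih, ← multipleHarmonic_cons_one]
    funext N
    congr 1
    funext j
    refine Fin.cases ?_ (fun j => ?_) j <;> simp

/-- The sequence `N ↦ ζ_N({1}_j, 1̄, {1}_k)`. -/
noncomputable def innerSeq (k j : ℕ) : ℕ → ℝ := (nestedSum 1)^[j] (nestedSum (-1) (harmonicSymm k))

theorem innerSeq_succ (k j : ℕ) : innerSeq k (j + 1) = nestedSum 1 (innerSeq k j) :=
  Function.iterate_succ_apply' _ _ _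

theorem multipleHarmonic_zetaIndex (m k : ℕ) :
    (fun N => multipleHarmonic N (zetaIndex m k)) = nestedSum (-1) (innerSeq k m) := by
  rw [zetaIndex, multipleHarmonic_cons_neg_one, multipleHarmonic_ones_append,
    multipleHarmonic_cons_neg_one, multipleHarmonic_ones]
  rfl

/-! ### The polylogarithm series grouped by its largest index -/

/-- Splitting off the leading entry of a decreasing tuple of positive integers. -/
def posDecreasingEquiv (r : ℕ) :
    PosDecreasing (r + 1) ≃ Σ n : ℕ, {t : Fin r → ℕ // t ∈ decreasingTuples n r} where
  toFun n := ⟨n.1 0 - 1, Fin.tail n.1, tail_mem_decreasingTuples n.2.1 n.2.2⟩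
  invFun x := ⟨Fin.cons (x.1 + 1) x.2.1, by
    have h := mem_decreasingTuples.1 (cons_mem_decreasingTuples (Nat.lt_succ_self x.1) x.2.2)
    exact ⟨h.2, fun i => (h.1 i).1⟩⟩
  left_inv n := by
    apply Subtype.ext
    have := n.2.2 0
    have h : n.1 0 - 1 + 1 = n.1 0 := by omega
    simp only [h, Fin.cons_self_tail]
  right_inv x := by
    rcases x with ⟨i, t, ht⟩
    simp only [Fin.tail_cons]
    rfl

/-- For a fixed largest index the remaining tuples form a finite set, whose sum is an elementary
symmetric function. The terms are nonnegative, so summing in this order already gives summability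
over all tuples. -/
theorem hasSum_multiplePolylogTerm (p m : ℕ) {x z : ℝ} (hx : 0 ≤ x)
    (h : HasSum (fun n : ℕ => x ^ (n + 1) / ((n : ℝ) + 1) ^ p * harmonicSymm m n) z) :
    HasSum (multiplePolylogTerm (Matrix.vecCons p fun _ : Fin m => 1) x) z := by
  rw [← (posDecreasingEquiv m).symm.hasSum_iff]
  have key : ∀ n : ℕ, HasSum (fun t : {t : Fin m → ℕ // t ∈ decreasingTuples n m} =>
      (multiplePolylogTerm (Matrix.vecCons p fun _ : Fin m => 1) x ∘
        (posDecreasingEquiv m).symm) ⟨n, t⟩)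
      (x ^ (n + 1) / ((n : ℝ) + 1) ^ p * harmonicSymm m n) := by
    intro n
    rw [← congrFun (multipleHarmonic_ones m) n]
    simp only [multipleHarmonic]
    rw [Finset.mul_sum]
    rw [← Finset.sum_coe_sort (decreasingTuples n m)]
    convert hasSum_fintype _ using 2 with t
    simp only [Function.comp, multiplePolylogTerm, posDecreasingEquiv, Equiv.coe_fn_symm_mk,
      Fin.prod_univ_succ, Fin.cons_zero, Fin.cons_succ, Matrix.cons_val_zero, Matrix.cons_val_succ]
    simp only [div_eq_mul_inv, pow_one, mul_inv, one_mul, Finset.prod_inv_distrib, Int.sign_one,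
      Int.cast_one, one_pow, Int.natAbs_one, mul_assoc]
    push_cast
    rfl
  have hs : Summable (multiplePolylogTerm (Matrix.vecCons p fun _ : Fin m => 1) x ∘
      (posDecreasingEquiv m).symm) := by
    rw [summable_sigma_of_nonneg]
    · refine ⟨fun n => (key n).summable, ?_⟩
      simpa only [(key _).tsum_eq] using h.summable
    · intro a
      simp only [Function.comp, multiplePolylogTerm]
      positivity
  rw [h.unique (hs.hasSum.sigma key)]
  exact hs.hasSum

/-! ### Growth estimates and alternating convergence -/

/-- Growth at most polynomial in the harmonic numbers. -/
def HarmonicGrowth (A : ℕ → ℝ) : Prop := ∃ r : ℕ, ∀ n, |A n| ≤ (harmonic n : ℝ) ^ r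

theorem harmonic_nonneg_real (n : ℕ) : (0 : ℝ) ≤ harmonic n := by
  rcases Nat.eq_zero_or_pos n with rfl | h
  · simp
  · exact_mod_cast (harmonic_pos h.ne').le

theorem harmonic_eq_real (n : ℕ) :
    (harmonic n : ℝ) = ∑ i ∈ Finset.range n, ((i : ℝ) + 1)⁻¹ := by
  simp [harmonic]

theorem harmonic_mono_real {m n : ℕ} (h : m ≤ n) : (harmonic m : ℝ) ≤ harmonic n := by
  rw [harmonic_eq_real, harmonic_eq_real]
  exact Finset.sum_le_sum_of_subset_of_nonneg (Finset.range_mono h) fun i _ _ => by positivity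

theorem HarmonicGrowth.nestedSum {A : ℕ → ℝ} (hA : HarmonicGrowth A) {ε : ℝ} (hε : |ε| = 1) :
    HarmonicGrowth (nestedSum ε A) := by
  obtain ⟨r, hr⟩ := hA
  refine ⟨r + 1, fun n => ?_⟩
  rw [pow_succ', harmonic_eq_real n, Finset.sum_mul, ← harmonic_eq_real n]
  refine (Finset.abs_sum_le_sum_abs _ _).trans (Finset.sum_le_sum fun i hi => ?_)
  have hi' : (0 : ℝ) ≤ (i : ℝ) + 1 := by positivity
  rw [abs_mul, abs_div, abs_pow, hε, one_pow, abs_of_nonneg hi', one_div]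
  have := (hr i).trans (pow_le_pow_left₀ (harmonic_nonneg_real i)
    (harmonic_mono_real (Finset.mem_range.1 hi).le) r)
  gcongr

theorem harmonicGrowth_one : HarmonicGrowth fun _ => 1 := ⟨0, by simp⟩

theorem harmonicGrowth_harmonicSymm (r : ℕ) : HarmonicGrowth (harmonicSymm r) := by
  induction r with
  | zero => exact harmonicGrowth_one
  | succ r ih => rw [harmonicSymm_succ]; exact ih.nestedSum (by simp)

theorem harmonicGrowth_innerSeq (k j : ℕ) : HarmonicGrowth (innerSeq k j) := by
  induction j with
  | zero => exact (harmonicGrowth_harmonicSymm k).nestedSum (by simp)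
  | succ j ih => rw [innerSeq_succ]; exact ih.nestedSum (by simp)

/-- Powers of `log` are beaten by any positive power of `n`. The exponent `1/2` is a convenient
choice: any exponent in `(0, 1)` serves the decay and summability estimates. -/
theorem HarmonicGrowth.isBigO_sqrt {A : ℕ → ℝ} (hA : HarmonicGrowth A) :
    A =O[atTop] fun n : ℕ => (n : ℝ) ^ (1 / 2 : ℝ) := by
  obtain ⟨r, hr⟩ := hA
  have h1 : A =O[atTop] fun n : ℕ => (1 + Real.log n) ^ r := by
    refine Asymptotics.IsBigO.of_bound 1 ?_
    filter_upwards with n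
    rw [Real.norm_eq_abs, Real.norm_eq_abs, one_mul]
    refine (hr n).trans ((pow_le_pow_left₀ (harmonic_nonneg_real n)
      (harmonic_le_one_add_log n) r).trans (le_abs_self _))
  have h2 : (fun x : ℝ => (1 + Real.log x) ^ r) =O[atTop] fun x : ℝ => Real.log x ^ r := by
    refine Asymptotics.IsBigO.pow ?_ r
    exact (Real.isLittleO_const_log_atTop (c := 1)).isBigO.add (Asymptotics.isBigO_refl _ _)
  have h3 : (fun x : ℝ => Real.log x ^ r) =O[atTop] fun x : ℝ => x ^ (1 / 2 : ℝ) := by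
    have := (isLittleO_log_rpow_rpow_atTop (s := 1 / 2) (r : ℝ) (by norm_num)).isBigO
    simpa only [Real.rpow_natCast] using this
  exact h1.trans ((h2.trans h3).comp_tendsto tendsto_natCast_atTop_atTop)

theorem HarmonicGrowth.tendsto_div {A : ℕ → ℝ} (hA : HarmonicGrowth A) :
    Tendsto (fun n : ℕ => A n / ((n : ℝ) + 1)) atTop (𝓝 0) := by
  have h1 : (fun n : ℕ => A n / ((n : ℝ) + 1)) =O[atTop]
      fun n : ℕ => (n : ℝ) ^ (-(1 / 2) : ℝ) := by
    have h2 : (fun n : ℕ => ((n : ℝ) + 1)⁻¹) =O[atTop] fun n : ℕ => (n : ℝ)⁻¹ := by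
      refine Asymptotics.IsBigO.of_bound 1 ?_
      filter_upwards [eventually_gt_atTop 0] with n hn
      have : (0 : ℝ) < n := by exact_mod_cast hn
      rw [Real.norm_of_nonneg (by positivity), Real.norm_of_nonneg (by positivity), one_mul]
      gcongr
      linarith
    refine (hA.isBigO_sqrt.mul h2).congr' (by simp [div_eq_mul_inv]) ?_
    filter_upwards [eventually_gt_atTop 0] with n hn
    have : (0 : ℝ) < n := by exact_mod_cast hn
    rw [← Real.rpow_neg_one, ← Real.rpow_add this]
    norm_num
  exact h1.trans_tendsto
    ((tendsto_rpow_neg_atTop (by norm_num : (0 : ℝ) < 1 / 2)).comp tendsto_natCast_atTop_atTop)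

theorem HarmonicGrowth.summable_div_sq {A : ℕ → ℝ} (hA : HarmonicGrowth A) :
    Summable fun n : ℕ => A n / (((n : ℝ) + 1) * ((n : ℝ) + 2)) := by
  refine summable_of_isBigO_nat (g := fun n : ℕ => (n : ℝ) ^ (-(3 / 2) : ℝ))
    (Real.summable_nat_rpow.2 (by norm_num)) ?_
  have h2 : (fun n : ℕ => (((n : ℝ) + 1) * ((n : ℝ) + 2))⁻¹) =O[atTop]
      fun n : ℕ => ((n : ℝ) * n)⁻¹ := by
    refine Asymptotics.IsBigO.of_bound 1 ?_
    filter_upwards [eventually_gt_atTop 0] with n hn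
    have : (0 : ℝ) < n := by exact_mod_cast hn
    rw [Real.norm_of_nonneg (by positivity), Real.norm_of_nonneg (by positivity), one_mul]
    gcongr <;> linarith
  refine (hA.isBigO_sqrt.mul h2).congr' (by simp [div_eq_mul_inv]) ?_
  filter_upwards [eventually_gt_atTop 0] with n hn
  have : (0 : ℝ) < n := by exact_mod_cast hn
  rw [mul_inv, ← Real.rpow_neg_one, ← Real.rpow_add this, ← Real.rpow_add this]
  norm_num

theorem HarmonicGrowth.summable_mul_pow {A : ℕ → ℝ} (hA : HarmonicGrowth A) {x : ℝ}
    (hx : |x| < 1) : Summable fun n : ℕ => A n * x ^ n := by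
  have h := summable_norm_pow_mul_geometric_of_norm_lt_one (R := ℝ) 1 hx
  refine summable_of_isBigO_nat h ?_
  have h1 : A =O[atTop] fun n : ℕ => (n : ℝ) ^ 1 := by
    refine hA.isBigO_sqrt.trans (Asymptotics.IsBigO.of_bound 1 ?_)
    filter_upwards [eventually_gt_atTop 0] with n hn
    have : (1 : ℝ) ≤ n := by exact_mod_cast hn
    rw [Real.norm_of_nonneg (by positivity), Real.norm_of_nonneg (by positivity), one_mul]
    calc (n : ℝ) ^ (1 / 2 : ℝ) ≤ (n : ℝ) ^ (1 : ℝ) :=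
          Real.rpow_le_rpow_of_exponent_le this (by norm_num)
      _ = _ := by simp
  exact (h1.mul (Asymptotics.isBigO_refl (fun n : ℕ => x ^ n) atTop)).norm_right

/-- A null sequence of bounded variation has a convergent alternating series. -/
theorem exists_tendsto_alternating {c : ℕ → ℝ} (h0 : Tendsto c atTop (𝓝 0))
    (habs : Summable fun n => |c n - c (n + 1)|) :
    ∃ z, Tendsto (fun N => ∑ n ∈ Finset.range N, (-1 : ℝ) ^ n * c n) atTop (𝓝 z) := by
  have hs' : Summable fun n => (-1 : ℝ) ^ n * (c n - c (n + 1)) := by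
    refine Summable.of_norm ?_
    simpa [abs_mul] using habs
  have hlim : Tendsto (fun N => (-1 : ℝ) ^ N * c N) atTop (𝓝 0) := by
    rw [tendsto_zero_iff_abs_tendsto_zero]
    refine ((tendsto_zero_iff_abs_tendsto_zero _).1 h0).congr fun N => ?_
    simp [abs_mul]
  -- Summation by parts: the partial sum up to `N` is exactly half of `c 0 - (-1)^N c N` plus the
  -- partial sum of `(-1)^n (c n - c (n+1))`.
  refine ⟨(c 0 - 0 + ∑' n, (-1 : ℝ) ^ n * (c n - c (n + 1))) / 2,
    (((tendsto_const_nhds.sub hlim).add hs'.hasSum.tendsto_sum_nat).div_const 2).congr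
      fun N => ?_⟩
  induction N with
  | zero => simp
  | succ N ih =>
    rw [Finset.sum_range_succ, Finset.sum_range_succ, ← ih]
    ring

/-- The inner nested sum has increments of size `|A n| / (n + 1)`, so after division by `n + 1` it
has bounded variation. Growth of the inner sequence alone would not give this. -/
theorem exists_tendsto_nestedSum_neg_one {A : ℕ → ℝ} (hA : HarmonicGrowth A) {ε : ℝ}
    (hε : |ε| = 1) : ∃ z, Tendsto (nestedSum (-1) (nestedSum ε A)) atTop (𝓝 z) := by
  have hB := hA.nestedSum hε
  have habs : Summable fun n : ℕ => |nestedSum ε A n / ((n : ℝ) + 1) -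
      nestedSum ε A (n + 1) / (((n + 1 : ℕ) : ℝ) + 1)| := by
    refine Summable.of_nonneg_of_le (fun n => abs_nonneg _) (fun n => ?_)
      (hB.summable_div_sq.abs.add hA.summable_div_sq.abs)
    have h1 : (n : ℝ) + 1 ≠ 0 := by positivity
    have h2 : (n : ℝ) + 2 ≠ 0 := by positivity
    have h3 : (((n + 1 : ℕ) : ℝ) + 1) = n + 2 := by push_cast; ring
    have : nestedSum ε A n / ((n : ℝ) + 1) - nestedSum ε A (n + 1) / (((n + 1 : ℕ) : ℝ) + 1)
        = nestedSum ε A n / (((n : ℝ) + 1) * ((n : ℝ) + 2)) -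
          ε ^ (n + 1) * (A n / (((n : ℝ) + 1) * ((n : ℝ) + 2))) := by
      rw [nestedSum_succ, h3]
      field_simp
      ring
    rw [this]
    refine (abs_sub _ _).trans (le_of_eq ?_)
    rw [abs_mul, abs_pow, hε, one_pow, one_mul]
  obtain ⟨z, hz⟩ := exists_tendsto_alternating hB.tendsto_div habs
  refine ⟨-z, hz.neg.congr fun N => ?_⟩
  rw [nestedSum, ← Finset.sum_neg_distrib]
  refine Finset.sum_congr rfl fun n _ => ?_
  ring

/-! ### Power series primitives and their derivatives -/

/-- The primitive `∑ a_n x ^ (n + 1) / (n + 1)` of the power series `∑ a_n x ^ n`. -/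
noncomputable def primSeries (a : ℕ → ℝ) (x : ℝ) : ℝ := ∑' n : ℕ, a n / ((n : ℝ) + 1) * x ^ (n + 1)

theorem primSeries_zero (a : ℕ → ℝ) : primSeries a 0 = 0 := by
  simp [primSeries]

theorem summable_primSeries {a : ℕ → ℝ} {x : ℝ} (hx : |x| < 1)
    (h : Summable fun n => a n * x ^ n) :
    Summable fun n : ℕ => a n / ((n : ℝ) + 1) * x ^ (n + 1) := by
  refine Summable.of_norm_bounded h.abs fun n => ?_
  rw [Real.norm_eq_abs, pow_succ, ← mul_assoc, abs_mul, abs_mul, abs_mul, abs_div,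
    abs_of_nonneg (by positivity : (0 : ℝ) ≤ (n : ℝ) + 1)]
  have h1 : |a n| / ((n : ℝ) + 1) ≤ |a n| :=
    div_le_self (abs_nonneg _) (by linarith [(Nat.cast_nonneg n : (0 : ℝ) ≤ n)])
  calc |a n| / ((n : ℝ) + 1) * |x ^ n| * |x| ≤ |a n| * |x ^ n| * 1 := by gcongr
    _ = _ := mul_one _

theorem hasDerivAt_primSeries {a : ℕ → ℝ} (h : ∀ x : ℝ, |x| < 1 → Summable fun n => a n * x ^ n)
    {x : ℝ} (hx : |x| < 1) : HasDerivAt (primSeries a) (∑' n, a n * x ^ n) x := by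
  obtain ⟨ρ, hxρ, hρ⟩ := exists_between hx
  have hρ0 : 0 < ρ := (abs_nonneg x).trans_lt hxρ
  have hρ' : |ρ| < 1 := by rwa [abs_of_pos hρ0]
  refine hasDerivAt_tsum_of_isPreconnected (t := Metric.ball 0 ρ) (y₀ := 0)
    (g := fun n x => a n / ((n : ℝ) + 1) * x ^ (n + 1)) (g' := fun n x => a n * x ^ n)
    (h ρ hρ').abs Metric.isOpen_ball (convex_ball _ _).isPreconnected ?_ ?_
    (Metric.mem_ball_self hρ0) ?_ (by simpa using hxρ)
  · intro n y _
    have h1 : (n : ℝ) + 1 ≠ 0 := by positivity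
    have := (hasDerivAt_pow (n + 1) y).const_mul (a n / ((n : ℝ) + 1))
    refine this.congr_deriv ?_
    push_cast
    field_simp
  · intro n y hy
    have hy' : |y| < ρ := by simpa using hy
    rw [Real.norm_eq_abs, abs_mul, abs_mul, abs_pow, abs_pow, abs_of_pos hρ0]
    gcongr
  · exact summable_primSeries (by simp) (h 0 (by simp))

theorem HarmonicGrowth.hasDerivAt_primSeries {A : ℕ → ℝ} (hA : HarmonicGrowth A) {x : ℝ}
    (hx : |x| < 1) : HasDerivAt (primSeries A) (∑' n, A n * x ^ n) x :=
  _root_.hasDerivAt_primSeries (fun _ h => hA.summable_mul_pow h) hx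

/-- Multiplying by `1 - x` takes differences of consecutive coefficients, which undoes the nested
sum; the sign `ε` is absorbed into the argument. -/
theorem tsum_nestedSum_mul_pow {A : ℕ → ℝ} (hA : HarmonicGrowth A) {ε : ℝ} (hε : |ε| = 1)
    {x : ℝ} (hx : |x| < 1) :
    ∑' n, nestedSum ε A n * x ^ n = primSeries A (ε * x) / (1 - x) := by
  have h1x : 1 - x ≠ 0 := by linarith [(abs_lt.1 hx).2]
  have hs := (hA.nestedSum hε).summable_mul_pow hx
  have hs' := (summable_nat_add_iff 1).2 hs
  rw [eq_div_iff h1x, mul_one_sub]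
  rw [← tsum_mul_right, sub_eq_iff_eq_add, hs.tsum_eq_zero_add,
    nestedSum_zero, zero_mul, zero_add,
    primSeries, ← Summable.tsum_add (summable_primSeries (by rwa [abs_mul, hε, one_mul])
      (hA.summable_mul_pow (by rwa [abs_mul, hε, one_mul]))) (hs.mul_right x)]
  refine tsum_congr fun n => ?_
  rw [nestedSum_succ, mul_pow]
  ring

theorem hasDerivAt_primSeries_nestedSum {A : ℕ → ℝ} (hA : HarmonicGrowth A) {ε : ℝ}
    (hε : |ε| = 1) {x : ℝ} (hx : |x| < 1) :
    HasDerivAt (primSeries (nestedSum ε A)) (primSeries A (ε * x) / (1 - x)) x := by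
  rw [← tsum_nestedSum_mul_pow hA hε hx]
  exact (hA.nestedSum hε).hasDerivAt_primSeries hx

theorem hasDerivAt_neg_log_one_sub {x : ℝ} (hx : x < 1) :
    HasDerivAt (fun x => -Real.log (1 - x)) (1 / (1 - x)) x := by
  have := (((hasDerivAt_id x).const_sub 1).log (by simp; linarith)).neg
  refine this.congr_deriv ?_
  simp [neg_div]

theorem hasDerivAt_pow_div_factorial {f : ℝ → ℝ} {f' x : ℝ} (hf : HasDerivAt f f' x) (n : ℕ) :
    HasDerivAt (fun x => f x ^ (n + 1) / ((n + 1).factorial : ℝ))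
      (f x ^ n / (n.factorial : ℝ) * f') x := by
  have := (hf.pow (n + 1)).div_const ((n + 1).factorial : ℝ)
  refine this.congr_deriv ?_
  rw [Nat.factorial_succ]
  have : (n.factorial : ℝ) ≠ 0 := by positivity
  push_cast
  field_simp

theorem primSeries_harmonicSymm (r : ℕ) {x : ℝ} (hx : |x| < 1) :
    primSeries (harmonicSymm r) x =
      (-Real.log (1 - x)) ^ (r + 1) / ((r + 1).factorial : ℝ) := by
  -- Two functions vanishing at `0` with a common derivative `F` on `(-1, 1)` agree; the recursion
  -- on `r` serves only to identify `F`.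
  suffices H : ∀ F : ℝ → ℝ, (∀ y, |y| < 1 → HasDerivAt (primSeries (harmonicSymm r)) (F y) y) →
      (∀ y, |y| < 1 → HasDerivAt
        (fun x => (-Real.log (1 - x)) ^ (r + 1) / ((r + 1).factorial : ℝ)) (F y) y) →
      primSeries (harmonicSymm r) x =
        (-Real.log (1 - x)) ^ (r + 1) / ((r + 1).factorial : ℝ) by
    refine H (fun y => (-Real.log (1 - y)) ^ r / (r.factorial : ℝ) * (1 / (1 - y)))
      (fun y hy => ?_) fun y hy => hasDerivAt_pow_div_factorial
        (hasDerivAt_neg_log_one_sub (abs_lt.1 hy).2) r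
    cases r with
    | zero =>
      have := harmonicGrowth_one.hasDerivAt_primSeries hy
      refine this.congr_deriv ?_
      simp [tsum_geometric_of_abs_lt_one hy]
    | succ r =>
      have := hasDerivAt_primSeries_nestedSum (harmonicGrowth_harmonicSymm r) (ε := 1)
        (by simp) hy
      rw [one_mul, primSeries_harmonicSymm r hy] at this
      rw [harmonicSymm_succ]
      refine this.congr_deriv ?_
      ring
  intro F h1 h2
  have hmem : ∀ y, y ∈ Metric.ball (0 : ℝ) 1 ↔ |y| < 1 := fun y => by simp
  have hd : ∀ y, |y| < 1 → HasDerivAt (fun x => primSeries (harmonicSymm r) x -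
      (-Real.log (1 - x)) ^ (r + 1) / ((r + 1).factorial : ℝ)) 0 y := fun y hy =>
    ((h1 y hy).sub (h2 y hy)).congr_deriv (sub_self _)
  have := Metric.isOpen_ball.is_const_of_deriv_eq_zero (convex_ball (0 : ℝ) 1).isPreconnected
    (fun y hy => (hd y ((hmem y).1 hy)).differentiableAt.differentiableWithinAt)
    (fun y hy => (hd y ((hmem y).1 hy)).deriv) ((hmem x).2 hx) ((hmem 0).2 (by simp))
  simp only [primSeries_zero, sub_zero, Real.log_one, neg_zero] at this
  rw [zero_pow (Nat.succ_ne_zero r), zero_div] at this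
  linarith
termination_by r

/-! ### Differential equations of the two polylogarithm families -/

/-- The polylogarithm `Li_{p + 1, {1}_m}` as a power series. -/
noncomputable def polylogOnes (m p : ℕ) : ℝ → ℝ :=
  primSeries fun n => harmonicSymm m n / ((n : ℝ) + 1) ^ p

theorem polylogOnes_zero_eq (m : ℕ) {x : ℝ} (hx : |x| < 1) :
    polylogOnes m 0 x = (-Real.log (1 - x)) ^ (m + 1) / ((m + 1).factorial : ℝ) := by
  simp only [polylogOnes, pow_zero, div_one]
  exact primSeries_harmonicSymm m hx

theorem summable_harmonicSymm_div_mul_pow (m p : ℕ) {x : ℝ} (hx : |x| < 1) :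
    Summable fun n : ℕ => harmonicSymm m n / ((n : ℝ) + 1) ^ p * x ^ n := by
  refine Summable.of_norm_bounded
    ((harmonicGrowth_harmonicSymm m).summable_mul_pow hx).abs fun n => ?_
  rw [Real.norm_eq_abs, abs_mul, abs_mul, abs_div,
    abs_of_nonneg (by positivity : (0 : ℝ) ≤ ((n : ℝ) + 1) ^ p)]
  gcongr
  exact div_le_self (abs_nonneg _)
    (one_le_pow₀ (by linarith [(Nat.cast_nonneg n : (0 : ℝ) ≤ n)]))

theorem hasSum_polylogOnes (m p : ℕ) {x : ℝ} (hx : |x| < 1) :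
    HasSum (fun n : ℕ => x ^ (n + 1) / ((n : ℝ) + 1) ^ (p + 1) * harmonicSymm m n)
      (polylogOnes m p x) := by
  refine (summable_primSeries hx (summable_harmonicSymm_div_mul_pow m p hx)).hasSum.congr_fun ?_
  intro n
  rw [pow_succ _ p]
  field_simp

theorem differentiableAt_polylogOnes (m p : ℕ) {x : ℝ} (hx : |x| < 1) :
    DifferentiableAt ℝ (polylogOnes m p) x :=
  (hasDerivAt_primSeries (fun _ h => summable_harmonicSymm_div_mul_pow m p h) hx).differentiableAt

theorem hasDerivAt_polylogOnes_zero (m : ℕ) {x : ℝ} (hx : |x| < 1) :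
    HasDerivAt (polylogOnes m 0)
      ((-Real.log (1 - x)) ^ m / (m.factorial : ℝ) * (1 / (1 - x))) x := by
  refine (hasDerivAt_pow_div_factorial
    (hasDerivAt_neg_log_one_sub (abs_lt.1 hx).2) m).congr_of_eventuallyEq ?_
  filter_upwards [(isOpen_lt continuous_abs continuous_const).mem_nhds hx] with y hy
  exact polylogOnes_zero_eq m hy

theorem hasDerivAt_polylogOnes_succ (m p : ℕ) {x : ℝ} (hx : |x| < 1) (hx0 : x ≠ 0) :
    HasDerivAt (polylogOnes m (p + 1)) (polylogOnes m p x / x) x := by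
  refine (hasDerivAt_primSeries
    (fun _ h => summable_harmonicSymm_div_mul_pow m (p + 1) h) hx).congr_deriv ?_
  rw [eq_div_iff hx0, ← tsum_mul_right, polylogOnes, primSeries]
  refine tsum_congr fun n => ?_
  rw [pow_succ _ p, pow_succ _ n]
  field_simp

/-- The power series `∑ (-1)^{n_{j+1}} x^{n₁} / (n₁ ⋯ n_{j+k+1})` over `n₁ > ⋯ > n_{j+k+1} ≥ 1`. -/
noncomputable def alternatingPolylog (k : ℕ) : ℕ → ℝ → ℝ
  | 0 => fun x => primSeries (harmonicSymm k) (-x)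
  | j + 1 => primSeries (innerSeq k j)

theorem hasDerivAt_alternatingPolylog_succ (k j : ℕ) {x : ℝ} (hx : |x| < 1) :
    HasDerivAt (alternatingPolylog k (j + 1)) (alternatingPolylog k j x / (1 - x)) x := by
  cases j with
  | zero =>
    have := hasDerivAt_primSeries_nestedSum (harmonicGrowth_harmonicSymm k) (ε := -1)
      (by simp) hx
    rw [neg_one_mul] at this
    exact this
  | succ j =>
    have := hasDerivAt_primSeries_nestedSum (harmonicGrowth_innerSeq k j) (ε := 1) (by simp) hx
    rw [one_mul, ← innerSeq_succ] at this
    exact this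

theorem abs_two_mul_sub_one_lt {v : ℝ} (hv : v ∈ Set.Ioo (0 : ℝ) 1) : |2 * v - 1| < 1 :=
  abs_lt.2 ⟨by linarith [hv.1], by linarith [hv.2]⟩

theorem abs_lt_one_of_mem_Ioo {v : ℝ} (hv : v ∈ Set.Ioo (0 : ℝ) 1) : |v| < 1 :=
  abs_lt.2 ⟨by linarith [hv.1], hv.2⟩

/-- The substitution `x = 2v - 1` turns `dx / (1 - x)` into `dv / (1 - v)` and `1 + x` into `2v`,
moving the points `-1` and `0` to `0` and `1/2`. -/
theorem hasDerivAt_alternatingPolylog_comp (k j : ℕ) {v : ℝ} (hv : v ∈ Set.Ioo (0 : ℝ) 1) :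
    HasDerivAt (fun v => alternatingPolylog k (j + 1) (2 * v - 1))
      (1 / (1 - v) * alternatingPolylog k j (2 * v - 1)) v := by
  have h1 : HasDerivAt (fun v : ℝ => 2 * v - 1) 2 v := by
    simpa using ((hasDerivAt_id v).const_mul 2).sub_const 1
  have h2 := (hasDerivAt_alternatingPolylog_succ k j (abs_two_mul_sub_one_lt hv)).comp v h1
  refine h2.congr_deriv ?_
  have : 1 - v ≠ 0 := by linarith [hv.2]
  have h3 : 1 - (2 * v - 1) = 2 * (1 - v) := by ring
  rw [h3]
  field_simp

theorem alternatingPolylog_zero_comp (k : ℕ) {v : ℝ} (hv : v ∈ Set.Ioo (0 : ℝ) 1) :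
    alternatingPolylog k 0 (2 * v - 1) =
      (-Real.log (2 * v)) ^ (k + 1) / ((k + 1).factorial : ℝ) := by
  have := primSeries_harmonicSymm k (x := -(2 * v - 1))
    (by rw [abs_neg]; exact abs_two_mul_sub_one_lt hv)
  refine this.trans ?_
  congr 4
  ring

/-! ### Repeated integration by parts and boundary limits -/

/-- A telescoping derivative: iterated primitives `f` against iterated primitives `g` with
respect to the weights `w` and `-w`. -/
theorem hasDerivAt_sum_antidiagonal {f g : ℕ → ℝ → ℝ} {f' : ℕ → ℝ} {w x : ℝ}
    (hf : ∀ j, HasDerivAt (f j) (f' j) x) (hf' : ∀ j, f' (j + 1) = w * f j x)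
    (hg0 : HasDerivAt (g 0) 0 x) (hg : ∀ i, HasDerivAt (g (i + 1)) (-(w * g i x)) x) (n : ℕ) :
    HasDerivAt (fun y => ∑ p ∈ antidiagonal n, f p.1 y * g p.2 y) (f' 0 * g n x) x := by
  induction n generalizing f f' with
  | zero =>
    simp only [Finset.Nat.antidiagonal_zero, Finset.sum_singleton]
    exact ((hf 0).mul hg0).congr_deriv (by ring)
  | succ n ih =>
    simp only [Finset.Nat.sum_antidiagonal_succ]
    refine (((hf 0).mul (hg n)).add (ih (fun j => hf (j + 1)) fun j => hf' (j + 1))).congr_deriv ?_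
    rw [hf' 0]
    ring

theorem sum_antidiagonal_mul_zero_pow (c : ℕ → ℝ) (n : ℕ) :
    ∑ p ∈ antidiagonal n, c p.1 * ((0 : ℝ) ^ p.2 / (p.2.factorial : ℝ)) = c n := by
  rw [Finset.sum_eq_single (n, 0)]
  · simp
  · rintro ⟨a, b⟩ hab hne
    rw [Finset.HasAntidiagonal.mem_antidiagonal] at hab
    have hb : b ≠ 0 := by
      rintro rfl
      exact hne (by simpa using hab)
    simp [hb]
  · simp

theorem tendsto_primSeries_neg {A : ℕ → ℝ} {z : ℝ}
    (h : Tendsto (nestedSum (-1) A) atTop (𝓝 z)) :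
    Tendsto (fun y => primSeries A (-y)) (𝓝[<] 1) (𝓝 z) := by
  have h1 := Real.tendsto_tsum_powerSeries_nhdsWithin_lt h
  -- `primSeries` has powers `y ^ (n + 1)` where Abel's theorem has `y ^ n`; the extra factor `y`
  -- tends to `1`.
  have h2 : Tendsto (fun y : ℝ => y) (𝓝[<] 1) (𝓝 1) := tendsto_id.mono_left nhdsWithin_le_nhds
  have h3 := h2.mul h1
  rw [one_mul] at h3
  refine h3.congr fun y => ?_
  rw [primSeries, ← tsum_mul_left]
  refine tsum_congr fun n => ?_
  rw [neg_pow y]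
  ring

theorem tendsto_alternatingPolylog_comp {k j : ℕ} {z : ℝ}
    (h : Tendsto (nestedSum (-1) (innerSeq k j)) atTop (𝓝 z)) :
    Tendsto (fun v => alternatingPolylog k (j + 1) (2 * v - 1)) (𝓝[>] 0) (𝓝 z) := by
  have h1 : Tendsto (fun v : ℝ => 1 - 2 * v) (𝓝[>] 0) (𝓝[<] 1) := by
    refine tendsto_nhdsWithin_iff.2 ⟨?_, ?_⟩
    · have : Continuous fun v : ℝ => 1 - 2 * v := by fun_prop
      simpa using (this.tendsto 0).mono_left nhdsWithin_le_nhds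
    · filter_upwards [self_mem_nhdsWithin] with v hv
      have : (0 : ℝ) < v := hv
      simp only [Set.mem_Iio]
      linarith
  refine ((tendsto_primSeries_neg h).comp h1).congr fun v => ?_
  simp only [Function.comp, neg_sub]
  rfl

theorem exists_tendsto_nestedSum_innerSeq (k j : ℕ) :
    ∃ z, Tendsto (nestedSum (-1) (innerSeq k j)) atTop (𝓝 z) := by
  cases j with
  | zero => exact exists_tendsto_nestedSum_neg_one (harmonicGrowth_harmonicSymm k) (by simp)
  | succ j =>
    rw [innerSeq_succ]
    exact exists_tendsto_nestedSum_neg_one (harmonicGrowth_innerSeq k j) (by simp)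

/-- The polylogarithm is differentiable and vanishes at `0`, hence is `O(v)`, which outweighs every
power of the logarithm. -/
theorem tendsto_polylogOnes_mul_log_pow (m p i : ℕ) :
    Tendsto (fun v => polylogOnes m p v * ((-Real.log (2 * v)) ^ i / (i.factorial : ℝ)))
      (𝓝[>] 0) (𝓝 0) := by
  have h1 : polylogOnes m p =O[𝓝[>] 0] fun v => v := by
    have := (differentiableAt_polylogOnes m p (x := 0) (by simp)).isBigO_sub
    simp only [polylogOnes, primSeries_zero, sub_zero] at this
    exact this.mono nhdsWithin_le_nhds
  have h2 : Tendsto (fun v : ℝ => 2 * v) (𝓝[>] 0) (𝓝[>] 0) := by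
    refine tendsto_nhdsWithin_iff.2 ⟨?_, ?_⟩
    · have : Continuous fun v : ℝ => 2 * v := by fun_prop
      simpa using (this.tendsto 0).mono_left nhdsWithin_le_nhds
    · filter_upwards [self_mem_nhdsWithin] with v hv
      have : (0 : ℝ) < v := hv
      simp only [Set.mem_Ioi]
      linarith
  -- With `t = -log (2v)` one has `v = e^(-t) / 2`, so this is the decay of `t^i e^(-t)`.
  have h3 := (Real.tendsto_pow_mul_exp_neg_atTop_nhds_zero i).comp
    (tendsto_neg_atBot_atTop.comp (Real.tendsto_log_nhdsGT_zero.comp h2))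
  have h4 : Tendsto (fun v : ℝ => v * ((-Real.log (2 * v)) ^ i / (i.factorial : ℝ)))
      (𝓝[>] 0) (𝓝 0) := by
    have h5 := h3.div_const (2 * (i.factorial : ℝ))
    rw [zero_div] at h5
    refine h5.congr' ?_
    filter_upwards [self_mem_nhdsWithin] with v hv
    have : (0 : ℝ) < v := hv
    simp only [Function.comp, neg_neg]
    rw [Real.exp_log (by linarith)]
    field_simp
  exact (h1.mul (Asymptotics.isBigO_refl _ _)).trans_tendsto h4

/-! ### Comparison of the two sums and passage to the limit -/

theorem hasDerivAt_sum_alternatingPolylog (k m : ℕ) {v : ℝ} (hv : v ∈ Set.Ioo (0 : ℝ) 1) :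
    HasDerivAt (fun v => ∑ p ∈ antidiagonal m, alternatingPolylog k (p.1 + 1) (2 * v - 1) *
        (Real.log (1 - v) ^ p.2 / (p.2.factorial : ℝ)))
      (1 / (1 - v) * ((-Real.log (2 * v)) ^ (k + 1) / ((k + 1).factorial : ℝ)) *
        (Real.log (1 - v) ^ m / (m.factorial : ℝ))) v := by
  rw [← alternatingPolylog_zero_comp k hv]
  refine hasDerivAt_sum_antidiagonal (w := 1 / (1 - v))
    (f := fun j v => alternatingPolylog k (j + 1) (2 * v - 1))
    (f' := fun j => 1 / (1 - v) * alternatingPolylog k j (2 * v - 1))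
    (g := fun i v => Real.log (1 - v) ^ i / (i.factorial : ℝ))
    (fun j => hasDerivAt_alternatingPolylog_comp k j hv) (fun j => rfl) ?_ (fun i => ?_) m
  · simpa using hasDerivAt_const v (1 : ℝ)
  · have h := (hasDerivAt_neg_log_one_sub hv.2).neg
    have h' := hasDerivAt_pow_div_factorial h i
    simp only [Pi.neg_apply, neg_neg] at h'
    exact h'.congr_deriv (by ring)

theorem hasDerivAt_sum_polylogOnes (k m : ℕ) {v : ℝ} (hv : v ∈ Set.Ioo (0 : ℝ) 1) :
    HasDerivAt (fun v => ∑ p ∈ antidiagonal (k + 1), polylogOnes m p.1 v *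
        ((-Real.log (2 * v)) ^ p.2 / (p.2.factorial : ℝ)))
      ((-Real.log (1 - v)) ^ m / (m.factorial : ℝ) * (1 / (1 - v)) *
        ((-Real.log (2 * v)) ^ (k + 1) / ((k + 1).factorial : ℝ))) v := by
  have hv' := abs_lt_one_of_mem_Ioo hv
  have hv0 : v ≠ 0 := hv.1.ne'
  -- Level `0` is a primitive for `1 / (1 - v)` rather than for the weight `1 / v`, so its
  -- derivative is given separately.
  refine hasDerivAt_sum_antidiagonal (w := 1 / v) (f := polylogOnes m)
    (f' := fun j => Nat.casesOn j ((-Real.log (1 - v)) ^ m / (m.factorial : ℝ) * (1 / (1 - v)))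
      fun j => 1 / v * polylogOnes m j v)
    (g := fun i v => (-Real.log (2 * v)) ^ i / (i.factorial : ℝ))
    (fun j => ?_) (fun j => rfl) ?_ (fun i => ?_) (k + 1)
  · cases j with
    | zero => exact hasDerivAt_polylogOnes_zero m hv'
    | succ j => exact (hasDerivAt_polylogOnes_succ m j hv' hv0).congr_deriv (by ring)
  · simpa using hasDerivAt_const v (1 : ℝ)
  · have h : HasDerivAt (fun v : ℝ => 2 * v) 2 v := by
      simpa using (hasDerivAt_id v).const_mul 2
    have h2 : HasDerivAt (fun v : ℝ => -Real.log (2 * v)) (-(2 / (2 * v))) v :=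
      (h.log (by simpa using hv0)).neg
    refine (hasDerivAt_pow_div_factorial h2 i).congr_deriv ?_
    field_simp

theorem sum_alternatingPolylog_eq (k m : ℕ) {v : ℝ} (hv : v ∈ Set.Ioo (0 : ℝ) 1) :
    ∑ p ∈ antidiagonal m, alternatingPolylog k (p.1 + 1) (2 * v - 1) *
        (Real.log (1 - v) ^ p.2 / (p.2.factorial : ℝ)) =
      (-1) ^ m * ∑ p ∈ antidiagonal (k + 1), polylogOnes m p.1 v *
        ((-Real.log (2 * v)) ^ p.2 / (p.2.factorial : ℝ)) +
      (-1) ^ (m + 1) * polylogOnes m (k + 1) (1 / 2) := by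
  have hd : ∀ y ∈ Set.Ioo (0 : ℝ) 1, HasDerivAt (fun v =>
      (∑ p ∈ antidiagonal m, alternatingPolylog k (p.1 + 1) (2 * v - 1) *
        (Real.log (1 - v) ^ p.2 / (p.2.factorial : ℝ))) -
      (-1) ^ m * ∑ p ∈ antidiagonal (k + 1), polylogOnes m p.1 v *
        ((-Real.log (2 * v)) ^ p.2 / (p.2.factorial : ℝ))) 0 y := by
    intro y hy
    refine ((hasDerivAt_sum_alternatingPolylog k m hy).sub
      ((hasDerivAt_sum_polylogOnes k m hy).const_mul ((-1) ^ m))).congr_deriv ?_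
    rw [neg_pow (Real.log (1 - y)) m]
    have : ((-1 : ℝ) ^ m) * (-1) ^ m = 1 := by rw [← mul_pow]; simp
    linear_combination (-(1 / (1 - y) * ((-Real.log (2 * y)) ^ (k + 1) /
      ((k + 1).factorial : ℝ)) * (Real.log (1 - y) ^ m / (m.factorial : ℝ)))) * this
  have hhalf : (1 / 2 : ℝ) ∈ Set.Ioo (0 : ℝ) 1 := by constructor <;> norm_num
  have := isOpen_Ioo.is_const_of_deriv_eq_zero isPreconnected_Ioo
    (fun y hy => (hd y hy).differentiableAt.differentiableWithinAt)
    (fun y hy => (hd y hy).deriv) hv hhalf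
  -- At `v = 1/2` both `2v - 1` and `log (2v)` vanish: the first sum is `0` and the second keeps
  -- only its term without logarithm.
  have e1 : (2 : ℝ) * (1 / 2) = 1 := by norm_num
  simp only [e1, sub_self, Real.log_one, neg_zero, alternatingPolylog, primSeries_zero, zero_mul,
    Finset.sum_const_zero] at this
  rw [sum_antidiagonal_mul_zero_pow fun j => polylogOnes m j (1 / 2)] at this
  rw [pow_succ]
  simp only [alternatingPolylog]
  linear_combination this

theorem tendsto_nestedSum_innerSeq (k m : ℕ) :
    Tendsto (nestedSum (-1) (innerSeq k m)) atTop
      (𝓝 ((-1) ^ (m + 1) * polylogOnes m (k + 1) (1 / 2))) := by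
  choose z hz using exists_tendsto_nestedSum_innerSeq k
  have hlog : Tendsto (fun v : ℝ => Real.log (1 - v)) (𝓝[>] 0) (𝓝 0) := by
    have : ContinuousAt (fun v : ℝ => Real.log (1 - v)) 0 := by
      refine ContinuousAt.log (by fun_prop) (by norm_num)
    have h := this.tendsto
    simp only [sub_zero, Real.log_one] at h
    exact h.mono_left nhdsWithin_le_nhds
  have h1 : Tendsto (fun v => ∑ p ∈ antidiagonal m,
      alternatingPolylog k (p.1 + 1) (2 * v - 1) *
        (Real.log (1 - v) ^ p.2 / (p.2.factorial : ℝ))) (𝓝[>] 0) (𝓝 (z m)) := by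
    -- Since `log (1 - v) → 0`, only the term without logarithm survives; the others vanish because
    -- every lower limit `z j` is finite.
    rw [← sum_antidiagonal_mul_zero_pow z m]
    exact tendsto_finsetSum _ fun p _ =>
      (tendsto_alternatingPolylog_comp (hz p.1)).mul ((hlog.pow p.2).div_const _)
  have h2 : Tendsto (fun v => ∑ p ∈ antidiagonal (k + 1), polylogOnes m p.1 v *
        ((-Real.log (2 * v)) ^ p.2 / (p.2.factorial : ℝ))) (𝓝[>] 0) (𝓝 0) := by
    have := tendsto_finsetSum (antidiagonal (k + 1)) fun (p : ℕ × ℕ) _ =>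
      tendsto_polylogOnes_mul_log_pow m p.1 p.2
    simpa using this
  have h3 := (h2.const_mul ((-1) ^ m)).add_const ((-1) ^ (m + 1) * polylogOnes m (k + 1) (1 / 2))
  rw [mul_zero, zero_add] at h3
  have h4 := h3.congr' (f₂ := fun v => ∑ p ∈ antidiagonal m,
      alternatingPolylog k (p.1 + 1) (2 * v - 1) *
        (Real.log (1 - v) ^ p.2 / (p.2.factorial : ℝ))) (by
    filter_upwards [Ioo_mem_nhdsGT (zero_lt_one' ℝ)] with v hv
    exact (sum_alternatingPolylog_eq k m hv).symm)
  rw [← tendsto_nhds_unique h1 h4]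
  exact hz m

theorem theorem3p2 (m k : ℕ) :
    Summable (multiplePolylogTerm (polylogIndex m k) (1 / 2)) ∧
      HasMultipleZetaValue (zetaIndex m k)
        ((-1 : ℝ) ^ (m + 1) * multiplePolylog (polylogIndex m k) (1 / 2)) := by
  have h := hasSum_multiplePolylogTerm (k + 2) m (by norm_num)
    (hasSum_polylogOnes m (k + 1) (x := 1 / 2) (by rw [abs_of_pos] <;> norm_num))
  refine ⟨h.summable, ?_⟩
  have h' : multiplePolylog (polylogIndex m k) (1 / 2) = polylogOnes m (k + 1) (1 / 2) :=
    h.tsum_eq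
  rw [HasMultipleZetaValue, h', multipleHarmonic_zetaIndex]
  exact tendsto_nestedSum_innerSeq k m
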